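/- Let $p$ be a prime, let $a,m\ge 1$ be integers, and let $R=GR(p^a,m)$ be the Galois ring of characteristic $p^a$ with $p^{am}$ elements, i.e. $R\cong(\mathbb Z/p^a)[y]/(\varphi)$ with $\varphi$ monic of degree $m$ and irreducible modulo $p$. For $u\in R[x]$ let $\bar u\in(R/pR)[x]=\mathbb F_{p^m}[x]$ be its reduction modulo $p$. Let $f\in R[x]$ be regular (not a zero divisor) and let $\mathcal R=R[x]/\langle f\rangle$. A polynomial $h\in R[x]$ is called basic irreducible if $h$ and $\bar h$ are irreducible. A primary coprime factorization of $f$ is an expression $f=\delta g_1\cdots g_r$ ($r\ge 0$) in which $\delta\in R[x]$ is a unit and $g_1,\dots,g_r\in R[x]$ are regular non-units, each $\langle g_i\rangle$ is a primary ideal, and $\langle g_i\rangle+\langle g_j\rangle=R[x]$ for $i\ne j$. The squarefree part of $\bar f$ is the product of its distinct irreducible factors (determined up to a nonzero constant). A decomposition of $f$ is an expression $f=f'\alpha+p\gamma$ with $f',\alpha,\gamma\in R[x]$ such that $\overline{f'}$ is the squarefree part of $\bar f$. Then the following are equivalent. 1. $\mathcal R$ is not a principal ideal ring. 2. $a>1$,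 and some primary coprime factorization of $f$ has a factor $g_i$ of the form $g_i=h^t+p\beta$ with $h\in R[x]$ basic irreducible, $t>1$, $\beta\in R[x]$ and $\beta\in\langle p,h\rangle$. 3. $a>1$, $\bar f$ is not squarefree, and for every decomposition $f=f'\alpha+p\gamma$ either $\bar\gamma=0$ or $\bar\alpha$ and $\bar\gamma$ are not coprime. 4. $a>1$, $\bar f$ is not squarefree, and there is a decomposition $f=f'\alpha+p\gamma$ for which either $\bar\gamma=0$ or $\bar\alpha$ and $\bar\gamma$ are not coprime. -/

import Mathlib

open Polynomial

/-- The canonical projection `f ↦ f̄` from `R[x]` to `(R / pR)[x]`, reducing every coefficient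
modulo `p`. When `R` is a Galois ring of characteristic `p ^ a`, the quotient `R / pR` is its
residue field. -/
noncomputable def reduceMod {R : Type*} [CommRing R] (p : ℕ) (f : R[X]) :
    (R ⧸ Ideal.span {(p : R)})[X] :=
  f.map (Ideal.Quotient.mk (Ideal.span {(p : R)}))

/-- A polynomial is basic irreducible if it is irreducible and stays irreducible modulo `p`. -/
def IsBasicIrreducible {R : Type*} [CommRing R] (p : ℕ) (h : R[X]) : Prop :=
  Irreducible h ∧ Irreducible (reduceMod p h)

/-- `R` is (a copy of) the Galois ring `GR(p ^ a, m)`, that is `(ℤ / p ^ a)[x] / (φ)` with `φ` a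
monic basic irreducible polynomial of degree `m`; different choices of `φ` give isomorphic rings. -/
def IsGaloisRing (p a m : ℕ) (R : Type*) [CommRing R] : Prop :=
  ∃ φ : (ZMod (p ^ a))[X],
    φ.Monic ∧ φ.natDegree = m ∧ IsBasicIrreducible p φ ∧ Nonempty (R ≃+* AdjoinRoot φ)

/-- A polynomial is regular if it is not a zero divisor. -/
def IsRegularPoly {R : Type*} [CommRing R] (f : R[X]) : Prop :=
  f ∈ nonZeroDivisors R[X]

/-- A polynomial which is not a unit is primary if the ideal it generates is a primary ideal. (The
ideal being proper is part of `Ideal.IsPrimary`.) -/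
def IsPrimaryPoly {R : Type*} [CommRing R] (f : R[X]) : Prop :=
  (Ideal.span {f}).IsPrimary

/-- `f = δ * g 0 * ⋯ * g (r - 1)` is a primary coprime factorization of `f`: the polynomial `δ` is a
unit, and the `g i` are regular primary polynomials that are not units and are pairwise coprime,
i.e. any two of them generate the unit ideal. -/
structure IsPrimaryCoprimeFactorization {R : Type*} [CommRing R] (f δ : R[X]) {r : ℕ}
    (g : Fin r → R[X]) : Prop where
  isUnit : IsUnit δ
  eq_mul_prod : f = δ * ∏ i, g i
  regular : ∀ i, IsRegularPoly (g i)
  primary : ∀ i, IsPrimaryPoly (g i)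
  coprime : ∀ i j, i ≠ j → IsCoprime (g i) (g j)

/-- `s` is the squarefree part of the nonzero polynomial `F`: up to a unit it is the product of the
distinct irreducible factors of `F`. -/
def IsSquarefreePart {K : Type*} [CommRing K] (s F : K[X]) : Prop :=
  Squarefree s ∧ s ∣ F ∧ ∀ q : K[X], Irreducible q → q ∣ F → q ∣ s

/-- `f = f' α + p γ`, where `f'` is a lift of the squarefree part of `f` modulo `p`. -/
def IsSquarefreeDecomposition {R : Type*} [CommRing R] (p : ℕ) (f f' α γ : R[X]) : Prop :=
  IsSquarefreePart (reduceMod p f') (reduceMod p f) ∧ f = f' * α + (p : R[X]) * γ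

/-! Each condition says that `a > 1` and `f` lies in `M ^ 2` for some maximal ideal `M = (p, h)` of
`R[x]` with `h` irreducible modulo `p`. When `a > 1`, `p * c = 0` forces `p ∣ c`, so `p` and `h`
form a basis of `M / M ^ 2` over `R[x] / M`. If `f` avoids every `M ^ 2`, it extends to a generating
pair of each `M` containing it; all primes of the quotient are then principal, hence all ideals are.
If `f ∈ M ^ 2`, the image of `M` still needs two generators. For condition 2, Hensel lifting factors
`f` into coprime lifts of prime powers; one factor carries the membership in `M ^ 2`, and `h ^ t + p
* β ∈ M ^ 2` means `t > 1` and `β ∈ M`. For conditions 3 and 4, `f' * α + p * γ ∈ M ^ 2` means that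
`h` divides `f'`, `α` and `γ` modulo `p`. -/

/-- A surjective ring homomorphism whose kernel is generated by the nilpotent element `π`. -/
structure IsNilpotentReduction {A D : Type*} [CommRing A] [CommRing D] (φ : A →+* D) (π : A) :
    Prop where
  surjective : Function.Surjective φ
  map_eq_zero_iff : ∀ x, φ x = 0 ↔ π ∣ x
  isNilpotent : IsNilpotent π

/-! ### Maximal ideals `(π, h)` and their squares. -/

namespace IsNilpotentReduction

variable {A D : Type*} [CommRing A] [CommRing D] {φ : A →+* D} {π : A}

theorem map_self (H : IsNilpotentReduction φ π) : φ π = 0 := (H.map_eq_zero_iff π).2 dvd_rfl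

theorem isUnit_one_add (H : IsNilpotentReduction φ π) (c : A) : IsUnit (1 + π * c) := by
  rw [add_comm]
  exact ((Commute.all π c).isNilpotent_mul_right H.isNilpotent).isUnit_add_one

theorem exists_of_map_eq (H : IsNilpotentReduction φ π) {x y : A} (h : φ x = φ y) :
    ∃ c, x = y + π * c := by
  obtain ⟨c, hc⟩ := (H.map_eq_zero_iff (x - y)).1 (by rw [map_sub, h, sub_self])
  exact ⟨c, by rw [← hc]; ring⟩

theorem isUnit_iff (H : IsNilpotentReduction φ π) {x : A} : IsUnit (φ x) ↔ IsUnit x := by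
  refine ⟨fun h => ?_, fun h => h.map φ⟩
  obtain ⟨y', hy⟩ := h.exists_right_inv
  obtain ⟨y, rfl⟩ := H.surjective y'
  obtain ⟨c, hc⟩ := H.exists_of_map_eq (x := x * y) (y := 1) (by simpa using hy)
  exact isUnit_of_mul_isUnit_left (hc ▸ H.isUnit_one_add c)

theorem irreducible_of_map (H : IsNilpotentReduction φ π) {h : A} (hh : Irreducible (φ h)) :
    Irreducible h := by
  refine ⟨fun hu => hh.not_isUnit (hu.map φ), fun a b hab => ?_⟩
  rw [← H.isUnit_iff, ← H.isUnit_iff (x := b)]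
  exact hh.isUnit_or_isUnit (by rw [hab, map_mul])

theorem isCoprime_of_map (H : IsNilpotentReduction φ π) {x y : A} (h : IsCoprime (φ x) (φ y)) :
    IsCoprime x y := by
  obtain ⟨s', t', hst⟩ := h
  obtain ⟨s, rfl⟩ := H.surjective s'
  obtain ⟨t, rfl⟩ := H.surjective t'
  obtain ⟨c, hc⟩ := H.exists_of_map_eq (x := s * x + t * y) (y := 1) (by simpa using hst)
  obtain ⟨w, hw⟩ := (H.isUnit_one_add c).exists_left_inv
  exact ⟨w * s, w * t, by rw [← hw, ← hc]; ring⟩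

theorem mem_span_pair (H : IsNilpotentReduction φ π) {h x : A} :
    x ∈ Ideal.span {π, h} ↔ φ h ∣ φ x := by
  rw [Ideal.mem_span_pair]
  constructor
  · rintro ⟨a, b, rfl⟩
    simp [H.map_self]
  · rintro ⟨c', hc⟩
    obtain ⟨c, rfl⟩ := H.surjective c'
    obtain ⟨e, he⟩ := H.exists_of_map_eq (x := x) (y := h * c) (by simpa using hc)
    exact ⟨e, c, by rw [he]; ring⟩

theorem mem_span_pair_sq {π h x : A} :
    x ∈ Ideal.span {π, h} ^ 2 ↔ ∃ a b c, x = a * π ^ 2 + b * (π * h) + c * h ^ 2 := by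
  rw [sq, Ideal.span_pair_mul_span_pair]
  simp only [Ideal.mem_span_insert, Ideal.mem_span_singleton']
  constructor
  · rintro ⟨a, _, ⟨b, _, ⟨c, _, ⟨d, rfl⟩, rfl⟩, rfl⟩, rfl⟩
    exact ⟨a, b + c, d, by ring⟩
  · rintro ⟨a, b, c, rfl⟩
    exact ⟨a, _, ⟨b, _, ⟨0, _, ⟨c, rfl⟩, rfl⟩, rfl⟩, by ring⟩

/-- `π` and `h` are linearly independent modulo the square of the ideal they generate. -/
theorem dvd_of_mem_span_pair_sq [IsDomain D]
    (H : IsNilpotentReduction φ π)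
    (hann : ∀ c, π * c = 0 → π ∣ c) {h : A} (hh : φ h ≠ 0) {u v : A}
    (huv : u * π + v * h ∈ Ideal.span {π, h} ^ 2) : φ h ∣ φ u ∧ φ h ∣ φ v := by
  obtain ⟨a, b, c, e⟩ := mem_span_pair_sq.1 huv
  have hv : φ v = φ (h * c) := by
    apply mul_right_cancel₀ hh
    have := congrArg φ e
    simp only [map_add, map_mul, map_pow, H.map_self] at this
    rw [map_mul]
    linear_combination this
  obtain ⟨w, hw⟩ := H.exists_of_map_eq hv
  -- Substituting `v = h * c + π * w` cancels `c * h ^ 2` and leaves a multiple of `π`, to which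
  -- `hann` applies.
  have h0 := (H.map_eq_zero_iff _).2 (hann (u + w * h - a * π - b * h) (by
    rw [hw] at e
    linear_combination e))
  simp only [map_sub, map_add, map_mul, H.map_self] at h0
  exact ⟨⟨φ b - φ w, by linear_combination h0⟩, hv ▸ ⟨φ c, by rw [map_mul]⟩⟩

/-- `w` has an inverse `t` modulo `(π, h)`, and `x = x * (1 - t * w) + t * (x * w)`. -/
theorem mem_of_mul_mem_span_pair_sq [IsPrincipalIdealRing D] (H : IsNilpotentReduction φ π)
    {h x w : A} (hh : Irreducible (φ h))
    (hw : ¬ φ h ∣ φ w) (hx : φ h ∣ φ x) (hxw : x * w ∈ Ideal.span {π, h} ^ 2) :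
    x ∈ Ideal.span {π, h} ^ 2 := by
  obtain ⟨s', t', hst⟩ := (hh.coprime_iff_not_dvd).2 hw
  obtain ⟨t, rfl⟩ := H.surjective t'
  have h1 : 1 - t * w ∈ Ideal.span {π, h} := H.mem_span_pair.2 ⟨s', by
    simp only [map_sub, map_one, map_mul]
    linear_combination -hst⟩
  have h2 : x * (1 - t * w) ∈ Ideal.span {π, h} ^ 2 := by
    rw [sq]
    exact Ideal.mul_mem_mul (H.mem_span_pair.2 hx) h1
  have := add_mem h2 (Ideal.mul_mem_left _ t hxw)
  convert this using 1
  ring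

theorem span_pair_eq_of_not_dvd [IsPrincipalIdealRing D]
    (H : IsNilpotentReduction φ π) {h u v : A}
    (hh : Irreducible (φ h)) (hu : ¬ φ h ∣ φ u) :
    Ideal.span {π, h} = Ideal.span {u * π + v * h, h} := by
  apply le_antisymm
  · obtain ⟨b', a', hab⟩ := (hh.coprime_iff_not_dvd).2 hu
    obtain ⟨a, rfl⟩ := H.surjective a'
    obtain ⟨b, rfl⟩ := H.surjective b'
    obtain ⟨c, hc⟩ := H.exists_of_map_eq (x := b * h + a * u) (y := 1) (by simpa using hab)
    obtain ⟨w, hw⟩ := (H.isUnit_one_add c).exists_left_inv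
    rw [Ideal.span_le]
    rintro x (rfl | rfl)
    · refine Ideal.mem_span_pair.2 ⟨w * a, w * (x * b - v * a), ?_⟩
      linear_combination x * w * hc + x * hw
    · exact Ideal.subset_span (by simp)
  · rw [Ideal.span_le]
    rintro x (rfl | rfl)
    · exact Ideal.mem_span_pair.2 ⟨_, _, rfl⟩
    · exact Ideal.subset_span (by simp)

/-- Some coefficient of `f = u * π + v * h` is invertible modulo `(π, h)`. If `u` is not, trading
`h` for `h + π` turns the coefficient of `π` into `u - v`, which is. -/
theorem exists_span_pair_eq [IsDomain D] [IsPrincipalIdealRing D]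
    (H : IsNilpotentReduction φ π) {h f : A}
    (hh : Irreducible (φ h)) (hf : φ h ∣ φ f) (hf2 : f ∉ Ideal.span {π, h} ^ 2) :
    ∃ g, Ideal.span {π, h} = Ideal.span {f, g} := by
  obtain ⟨u, v, rfl⟩ := Ideal.mem_span_pair.1 (H.mem_span_pair.2 hf)
  by_cases hu : φ h ∣ φ u
  · have hv : ¬ φ h ∣ φ v := fun hv => hf2 <| by
      rw [sq]
      exact add_mem (Ideal.mul_mem_mul (H.mem_span_pair.2 hu) (Ideal.subset_span (by simp)))
        (Ideal.mul_mem_mul (H.mem_span_pair.2 hv) (Ideal.subset_span (by simp)))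
    have hφ : φ (h + π) = φ h := by simp [H.map_self]
    refine ⟨h + π, ?_⟩
    have key := H.span_pair_eq_of_not_dvd (h := h + π) (u := u - v) (v := v) (hφ ▸ hh) (by
      rw [hφ, map_sub]
      exact fun hd => hv ((dvd_sub_right hu).1 hd))
    rw [show (u - v) * π + v * (h + π) = u * π + v * h by ring] at key
    rw [← key]
    ext x
    rw [H.mem_span_pair, H.mem_span_pair, hφ]
  · exact ⟨h, H.span_pair_eq_of_not_dvd hh hu⟩

/-- A prime contains the nilpotent `π`, so it is the preimage of a prime of `D`, nonzero because `φ
f ≠ 0`. -/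
theorem exists_span_pair_eq_of_isPrime [IsDomain D] [IsPrincipalIdealRing D]
    (H : IsNilpotentReduction φ π) {P : Ideal A}
    (hP : P.IsPrime) {f : A} (hf : φ f ≠ 0) (hfP : f ∈ P) :
    ∃ h, Irreducible (φ h) ∧ P = Ideal.span {π, h} := by
  have hπ : π ∈ P := by
    obtain ⟨n, hn⟩ := H.isNilpotent
    exact hP.mem_of_pow_mem n (hn ▸ P.zero_mem)
  have hker : RingHom.ker φ ≤ P := fun x hx => by
    obtain ⟨c, rfl⟩ := (H.map_eq_zero_iff x).1 hx
    exact P.mul_mem_right c hπ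
  have hprime : (P.map φ).IsPrime := Ideal.map_isPrime_of_surjective H.surjective hker
  obtain ⟨d, hd⟩ := (IsPrincipalIdealRing.principal (P.map φ)).principal
  obtain ⟨h, rfl⟩ := H.surjective d
  rw [Ideal.submodule_span_eq] at hd
  have hd0 : φ h ≠ 0 := by
    intro h0
    have := Ideal.mem_map_of_mem φ hfP
    rw [hd, h0, Ideal.mem_span_singleton, zero_dvd_iff] at this
    exact hf this
  refine ⟨h, ((Ideal.span_singleton_prime hd0).1 (hd ▸ hprime)).irreducible, ?_⟩
  ext x
  rw [H.mem_span_pair, ← Ideal.mem_span_singleton, ← hd]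
  refine ⟨Ideal.mem_map_of_mem φ, fun hx => ?_⟩
  obtain ⟨y, hy, hyx⟩ := (Ideal.mem_map_iff_of_surjective φ H.surjective).1 hx
  obtain ⟨c, rfl⟩ := H.exists_of_map_eq hyx.symm
  exact add_mem hy (P.mul_mem_right c hπ)

theorem isMaximal_span_pair [IsPrincipalIdealRing D]
    (H : IsNilpotentReduction φ π) {h : A} (hh : Irreducible (φ h)) :
    (Ideal.span {π, h}).IsMaximal := by
  have := PrincipalIdealRing.isMaximal_of_irreducible hh
  have e : Ideal.span {π, h} = (Ideal.span {φ h}).comap φ := by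
    ext x
    rw [H.mem_span_pair, Ideal.mem_comap, Ideal.mem_span_singleton]
  rw [e]
  exact Ideal.comap_isMaximal_of_surjective φ H.surjective

theorem isPrincipalIdealRing_quotient [IsDomain D] [IsPrincipalIdealRing D]
    (H : IsNilpotentReduction φ π) {f : A} (hf : φ f ≠ 0)
    (hf2 : ∀ h, Irreducible (φ h) → f ∉ Ideal.span {π, h} ^ 2) :
    IsPrincipalIdealRing (A ⧸ Ideal.span {f}) := by
  refine IsPrincipalIdealRing.of_prime fun P hP => ?_
  have hs : Function.Surjective (Ideal.Quotient.mk (Ideal.span {f})) := Ideal.Quotient.mk_surjective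
  have hf0 : Ideal.Quotient.mk (Ideal.span {f}) f = 0 :=
    Ideal.Quotient.eq_zero_iff_mem.2 (Ideal.mem_span_singleton_self f)
  have hfP : f ∈ P.comap (Ideal.Quotient.mk (Ideal.span {f})) := by
    rw [Ideal.mem_comap, hf0]
    exact P.zero_mem
  obtain ⟨h, hh, e⟩ := H.exists_span_pair_eq_of_isPrime (hP.comap _) hf hfP
  obtain ⟨g, hg⟩ := H.exists_span_pair_eq hh (H.mem_span_pair.1 (e ▸ hfP)) (hf2 h hh)
  refine ⟨Ideal.Quotient.mk _ g, ?_⟩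
  rw [← Ideal.map_comap_of_surjective _ hs P, e, hg, Ideal.map_span, Set.image_pair, hf0,
    Ideal.span_insert_zero]

/-- A single generator `g` of the image of `(π, h)` would generate it modulo its square, since `f`
lies there; this contradicts the independence of `π` and `h`. -/
theorem not_isPrincipalIdealRing_quotient [IsDomain D] [IsPrincipalIdealRing D]
    (H : IsNilpotentReduction φ π)
    (hann : ∀ c, π * c = 0 → π ∣ c) {f h : A} (hh : Irreducible (φ h))
    (hf : f ∈ Ideal.span {π, h} ^ 2) : ¬ IsPrincipalIdealRing (A ⧸ Ideal.span {f}) := by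
  intro hB
  obtain ⟨g', hg'⟩ := (hB.principal ((Ideal.span {π, h}).map
    (Ideal.Quotient.mk (Ideal.span {f})))).principal
  obtain ⟨g, rfl⟩ := Ideal.Quotient.mk_surjective g'
  rw [Ideal.submodule_span_eq] at hg'
  have aux : ∀ x ∈ Ideal.span {π, h}, ∃ y, x - y * g ∈ Ideal.span {π, h} ^ 2 := by
    intro x hx
    have := Ideal.mem_map_of_mem (Ideal.Quotient.mk (Ideal.span {f})) hx
    rw [hg', Ideal.mem_span_singleton'] at this
    obtain ⟨y', hy⟩ := this
    obtain ⟨y, rfl⟩ := Ideal.Quotient.mk_surjective y'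
    rw [← map_mul, eq_comm, Ideal.Quotient.mk_eq_mk_iff_sub_mem, Ideal.mem_span_singleton] at hy
    exact ⟨y, Ideal.mem_of_dvd _ hy hf⟩
  have hgM : g ∈ Ideal.span {π, h} := by
    have : Ideal.Quotient.mk (Ideal.span {f}) g ∈ (Ideal.span {π, h}).map
        (Ideal.Quotient.mk (Ideal.span {f})) := hg' ▸ Ideal.mem_span_singleton_self _
    obtain ⟨y, hy, hyg⟩ := (Ideal.mem_map_iff_of_surjective _ Ideal.Quotient.mk_surjective).1 this
    rw [eq_comm, Ideal.Quotient.mk_eq_mk_iff_sub_mem, Ideal.mem_span_singleton] at hyg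
    have := add_mem (Ideal.mem_of_dvd _ hyg (Ideal.pow_le_self two_ne_zero hf)) hy
    rwa [sub_add_cancel] at this
  obtain ⟨b, c, rfl⟩ := Ideal.mem_span_pair.1 hgM
  obtain ⟨x, hx⟩ := aux π (Ideal.subset_span (by simp))
  obtain ⟨y, hy⟩ := aux h (Ideal.subset_span (by simp))
  obtain ⟨h1, h2⟩ := H.dvd_of_mem_span_pair_sq hann hh.ne_zero (u := 1 - x * b) (v := -(x * c))
    (by convert hx using 1; ring)
  obtain ⟨-, h4⟩ := H.dvd_of_mem_span_pair_sq hann hh.ne_zero (u := -(y * b)) (v := 1 - y * c)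
    (by convert hy using 1; ring)
  simp only [map_sub, map_one, map_mul, map_neg, dvd_neg] at h1 h2 h4
  -- Modulo `φ h`: `x * b = 1`, `x * c = 0` and `y * c = 1`, which is impossible in a domain.
  rcases hh.prime.dvd_or_dvd h2 with hd | hd
  · exact hh.not_isUnit (isUnit_of_dvd_one ((dvd_sub_left (hd.mul_right _)).1 h1))
  · exact hh.not_isUnit (isUnit_of_dvd_one ((dvd_sub_left (hd.mul_left _)).1 h4))

end IsNilpotentReduction

/-! ### Hensel lifting and primary coprime factorizations. -/

namespace IsNilpotentReduction

variable {A D : Type*} [CommRing A] [CommRing D] {φ : A →+* D} {π : A}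

/-- Hensel lifting of a coprime factorization along a nilpotent reduction. -/
theorem exists_mul_eq (H : IsNilpotentReduction φ π) {f : A} {x y : D} (hxy : IsCoprime x y)
    (hf : φ f = x * y) : ∃ u v, f = u * v ∧ φ u = x ∧ φ v = y := by
  have step : ∀ n : ℕ, ∃ u v e, f = u * v + π ^ (n + 1) * e ∧ φ u = x ∧ φ v = y := by
    intro n
    induction n with
    | zero =>
      obtain ⟨u, rfl⟩ := H.surjective x
      obtain ⟨v, rfl⟩ := H.surjective y
      obtain ⟨e, he⟩ := H.exists_of_map_eq (hf.trans (map_mul φ u v).symm)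
      exact ⟨u, v, e, by simpa using he, rfl, rfl⟩
    | succ n ih =>
      obtain ⟨u, v, e, rfl, rfl, rfl⟩ := ih
      obtain ⟨s, t, hst⟩ := H.isCoprime_of_map hxy
      -- As `s * u + t * v = 1`, the corrections absorb the error `π ^ (n + 1) * e`; only their
      -- product, of order `π ^ (2 * n + 2)`, remains.
      refine ⟨u + π ^ (n + 1) * (t * e), v + π ^ (n + 1) * (s * e), -(π ^ n * s * t * e ^ 2),
        ?_, by simp [H.map_self], by simp [H.map_self]⟩
      linear_combination -π ^ (n + 1) * e * hst
  obtain ⟨n, hn⟩ := H.isNilpotent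
  obtain ⟨u, v, e, he, hu, hv⟩ := step n
  exact ⟨u, v, by rw [he, pow_succ, hn]; ring, hu, hv⟩

theorem exists_factorization [IsDomain D] [IsPrincipalIdealRing D]
    (H : IsNilpotentReduction φ π) {f : A} (hf : φ f ≠ 0) :
    ∃ (r : ℕ) (g : Fin r → A) (δ : A), IsUnit δ ∧ f = δ * ∏ i, g i ∧
      (∀ i, ∃ h t, Irreducible (φ h) ∧ t ≠ 0 ∧ φ (g i) = φ h ^ t) ∧
      ∀ i j, i ≠ j → IsCoprime (g i) (g j) := by
  obtain ⟨F, hF⟩ : ∃ F, φ f = F := ⟨_, rfl⟩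
  rw [hF] at hf
  induction F using UniqueFactorizationMonoid.induction_on_coprime generalizing f with
  | h0 => exact absurd rfl hf
  | h1 hx => exact ⟨0, Fin.elim0, f, H.isUnit_iff.1 (hF ▸ hx), by simp, fun i => i.elim0,
      fun i => i.elim0⟩
  | @hpr q i hq =>
    obtain ⟨h, rfl⟩ := H.surjective q
    rcases eq_or_ne i 0 with rfl | hi
    · exact ⟨0, Fin.elim0, f, H.isUnit_iff.1 (by simp [hF]), by simp, fun i => i.elim0,
        fun i => i.elim0⟩
    · exact ⟨1, fun _ => f, 1, isUnit_one, by simp, fun _ => ⟨h, i, hq.irreducible, hi, hF⟩,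
        fun i j hij => absurd (Subsingleton.elim i j) hij⟩
  | @hcp x y hxy ihx ihy =>
    have hxy' : IsCoprime x y := hxy.isCoprime
    obtain ⟨u, v, rfl, hu, hv⟩ := H.exists_mul_eq hxy' hF
    obtain ⟨r, g, δ, hδ, hg, hgi, hgc⟩ := ihx (left_ne_zero_of_mul hf) hu
    obtain ⟨s, k, ε, hε, hk, hki, hkc⟩ := ihy (right_ne_zero_of_mul hf) hv
    have huv : IsCoprime u v := H.isCoprime_of_map (hu ▸ hv ▸ hxy')
    have hgk : ∀ i j, IsCoprime (g i) (k j) := fun i j =>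
      (huv.of_isCoprime_of_dvd_left
        (hg ▸ (Finset.dvd_prod_of_mem g (Finset.mem_univ i)).mul_left δ)).of_isCoprime_of_dvd_right
        (hk ▸ (Finset.dvd_prod_of_mem k (Finset.mem_univ j)).mul_left ε)
    refine ⟨r + s, Fin.append g k, δ * ε, hδ.mul hε, ?_, ?_, ?_⟩
    · rw [Fin.prod_univ_add]
      simp only [Fin.append_left, Fin.append_right]
      rw [hg, hk]
      ring
    · intro i
      induction i using Fin.addCases with
      | left i => simpa using hgi i
      | right i => simpa using hki i
    · intro i j hij
      induction i using Fin.addCases with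
      | left i =>
        induction j using Fin.addCases with
        | left j => simpa using hgc i j (fun h => hij (by rw [h]))
        | right j => simpa using hgk i j
      | right i =>
        induction j using Fin.addCases with
        | left j => simpa using (hgk j i).symm
        | right j => simpa using hkc i j (fun h => hij (by rw [h]))

/-- The radical is the maximal ideal `(π, h)`. -/
theorem isPrimary_span_singleton [IsDomain D] [IsPrincipalIdealRing D]
    (H : IsNilpotentReduction φ π) {g h : A} {t : ℕ}
    (hh : Irreducible (φ h)) (ht : t ≠ 0) (hg : φ g = φ h ^ t) : (Ideal.span {g}).IsPrimary := by
  apply Ideal.isPrimary_of_isMaximal_radical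
  have hmax := H.isMaximal_span_pair hh
  suffices (Ideal.span {g}).radical = Ideal.span {π, h} by rwa [this]
  apply le_antisymm
  · rw [hmax.isPrime.radical_le_iff, Ideal.span_singleton_le_iff_mem, H.mem_span_pair, hg]
    exact dvd_pow_self _ ht
  · have hπ : π ∈ (Ideal.span {g}).radical := by
      obtain ⟨n, hn⟩ := H.isNilpotent
      exact ⟨n, hn ▸ Ideal.zero_mem _⟩
    rw [Ideal.span_le]
    rintro x (rfl | rfl)
    · exact hπ
    · obtain ⟨c, hc⟩ := H.exists_of_map_eq (x := x ^ t) (y := g) (by simp [hg])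
      refine (Ideal.radical_isRadical (Ideal.span {g})) ⟨t, ?_⟩
      rw [hc]
      exact add_mem (Ideal.le_radical (Ideal.mem_span_singleton_self g)) (Ideal.mul_mem_right _ _ hπ)

/-- A coprime factorization of an element of `(π, h) ^ 2` has a factor in `(π, h) ^ 2`. -/
theorem exists_factor_mem_sq [IsDomain D] [IsPrincipalIdealRing D]
    (H : IsNilpotentReduction φ π) {f h δ : A} {r : ℕ} {g : Fin r → A}
    (hh : Irreducible (φ h)) (hf : f ∈ Ideal.span {π, h} ^ 2) (hδ : IsUnit δ)
    (hfg : f = δ * ∏ i, g i) (hg : ∀ i j, i ≠ j → IsCoprime (g i) (g j)) :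
    ∃ i, g i ∈ Ideal.span {π, h} ^ 2 := by
  have hδ' : ¬ φ h ∣ φ δ := fun hd => hh.not_isUnit (isUnit_of_dvd_unit hd (hδ.map φ))
  have hdvd : φ h ∣ ∏ i, φ (g i) := by
    have := H.mem_span_pair.1 (Ideal.pow_le_self two_ne_zero hf)
    rw [hfg, map_mul, map_prod] at this
    exact (hh.prime.dvd_or_dvd this).resolve_left hδ'
  obtain ⟨i, -, hi⟩ := (hh.prime.dvd_finsetProd_iff _).1 hdvd
  -- The other factors are coprime to `g i`, so their product is invertible modulo `(π, h)` and
  -- cancels.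
  refine ⟨i, H.mem_of_mul_mem_span_pair_sq hh (w := δ * ∏ j ∈ Finset.univ.erase i, g j) ?_ hi ?_⟩
  · rw [map_mul, map_prod]
    intro hd
    obtain ⟨j, hj, hj'⟩ := (hh.prime.dvd_finsetProd_iff _).1
      ((hh.prime.dvd_or_dvd hd).resolve_left hδ')
    exact hh.not_isUnit (((hg i j (Finset.ne_of_mem_erase hj).symm).map φ).isUnit_of_dvd' hi hj')
  · rw [mul_left_comm, Finset.mul_prod_erase _ _ (Finset.mem_univ i), ← hfg]
    exact hf

theorem two_le_and_mem_of_mem_sq [IsDomain D]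
    (H : IsNilpotentReduction φ π) (hann : ∀ c, π * c = 0 → π ∣ c)
    {h β : A} {t : ℕ} (hh : Irreducible (φ h)) (hmem : h ^ t + π * β ∈ Ideal.span {π, h} ^ 2) :
    1 < t ∧ β ∈ Ideal.span {π, h} := by
  match t with
  | 0 =>
    have := H.mem_span_pair.1 (Ideal.pow_le_self two_ne_zero hmem)
    simp only [pow_zero, map_add, map_one, map_mul, H.map_self, zero_mul, add_zero] at this
    exact absurd (isUnit_of_dvd_one this) hh.not_isUnit
  | 1 =>
    have := (H.dvd_of_mem_span_pair_sq hann hh.ne_zero (u := β) (v := 1)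
      (by convert hmem using 1; ring)).2
    rw [map_one] at this
    exact absurd (isUnit_of_dvd_one this) hh.not_isUnit
  | t + 2 =>
    refine ⟨by omega, H.mem_span_pair.2 (H.dvd_of_mem_span_pair_sq hann hh.ne_zero
      (u := β) (v := 0) ?_).1⟩
    have h2 : h ^ (t + 2) ∈ Ideal.span {π, h} ^ 2 := mem_span_pair_sq.2 ⟨0, 0, h ^ t, by ring⟩
    convert sub_mem hmem h2 using 1
    ring

end IsNilpotentReduction

/-! ### The annihilator of `p` and the residue field of a Galois ring. -/

theorem Polynomial.natCast_dvd_iff_dvd_coeff {R : Type*} [CommRing R] (n : ℕ) (f : R[X]) :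
    (n : R[X]) ∣ f ↔ ∀ i, (n : R) ∣ f.coeff i := by
  rw [← C_dvd_iff_dvd_coeff, map_natCast]

theorem Polynomial.natCast_dvd_of_mul_eq_zero {R : Type*} [CommRing R] {n : ℕ}
    (hann : ∀ c : R, n * c = 0 → (n : R) ∣ c) (f : R[X]) (hf : n * f = 0) : (n : R[X]) ∣ f := by
  refine (natCast_dvd_iff_dvd_coeff n f).2 fun i => hann _ ?_
  rw [← map_natCast C] at hf
  rw [← coeff_C_mul, hf, coeff_zero]

/-- Remainders modulo the monic `q` represent classes uniquely, so the property is checked on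
coefficients. -/
theorem AdjoinRoot.natCast_dvd_of_mul_eq_zero {S : Type*} [CommRing S] {n : ℕ}
    (hann : ∀ c : S, n * c = 0 → (n : S) ∣ c) {q : S[X]} (hq : q.Monic) (c : AdjoinRoot q)
    (hc : n * c = 0) : (n : AdjoinRoot q) ∣ c := by
  obtain ⟨g, rfl⟩ := AdjoinRoot.mk_surjective c
  rw [← map_natCast (AdjoinRoot.mk q), ← map_mul, AdjoinRoot.mk_eq_zero,
    ← modByMonic_eq_zero_iff_dvd hq, ← map_natCast C, ← smul_eq_C_mul, smul_modByMonic,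
    smul_eq_C_mul, map_natCast] at hc
  obtain ⟨s, hs⟩ := Polynomial.natCast_dvd_of_mul_eq_zero hann _ hc
  refine ⟨AdjoinRoot.mk q s, ?_⟩
  rw [← map_natCast (AdjoinRoot.mk q), ← map_mul, ← hs, AdjoinRoot.mk_eq_mk,
    modByMonic_eq_sub_mul_div]
  exact ⟨g /ₘ q, by ring⟩

theorem ZMod.natCast_dvd_of_mul_eq_zero {p a : ℕ} (hp : p.Prime) (ha : 1 < a)
    (c : ZMod (p ^ a)) (hc : p * c = 0) : (p : ZMod (p ^ a)) ∣ c := by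
  have : NeZero (p ^ a) := ⟨(pow_pos hp.pos a).ne'⟩
  obtain ⟨k, rfl⟩ := ZMod.natCast_zmod_surjective c
  obtain ⟨b, rfl⟩ := Nat.exists_eq_add_of_lt ha
  rw [← Nat.cast_mul, ZMod.natCast_eq_zero_iff, show 1 + b + 1 = (b + 1) + 1 by ring,
    pow_succ' p (b + 1)] at hc
  exact Nat.cast_dvd_cast ((dvd_pow_self p b.succ_ne_zero).trans
    (Nat.dvd_of_mul_dvd_mul_left hp.pos hc))

theorem ZMod.isMaximal_span_prime {p a : ℕ} (hp : p.Prime) (ha : 1 ≤ a) :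
    (Ideal.span {(p : ZMod (p ^ a))}).IsMaximal := by
  have : Fact p.Prime := ⟨hp⟩
  have : NeZero (p ^ a) := ⟨(pow_pos hp.pos a).ne'⟩
  have hd : p ∣ p ^ a := dvd_pow_self p (by omega)
  have e : Ideal.span {(p : ZMod (p ^ a))} = RingHom.ker (ZMod.castHom hd (ZMod p)) := by
    ext c
    obtain ⟨k, rfl⟩ := ZMod.natCast_zmod_surjective c
    rw [Ideal.mem_span_singleton, RingHom.mem_ker, map_natCast, ZMod.natCast_eq_zero_iff]
    refine ⟨fun h => ?_, fun h => Nat.cast_dvd_cast h⟩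
    rw [← ZMod.natCast_eq_zero_iff, ← map_natCast (ZMod.castHom hd (ZMod p)) k]
    exact zero_dvd_iff.1 (by simpa using map_dvd (ZMod.castHom hd (ZMod p)) h)
  rw [e]
  exact RingHom.ker_isMaximal_of_surjective _ (ZMod.ringHom_surjective _)

namespace IsGaloisRing

variable {p a m : ℕ} {R : Type*} [CommRing R]

theorem natCast_pow_eq_zero (hR : IsGaloisRing p a m R) : (p : R) ^ a = 0 := by
  obtain ⟨q, -, -, -, ⟨e⟩⟩ := hR
  apply e.injective
  rw [map_pow, map_natCast, map_zero, ← map_natCast (AdjoinRoot.of q), ← map_pow, ← Nat.cast_pow,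
    ZMod.natCast_self, map_zero]

theorem natCast_pow_pred_ne_zero (hR : IsGaloisRing p a m R) (hp : p.Prime) (ha : 1 ≤ a)
    (hm : 1 ≤ m) : (p : R) ^ (a - 1) ≠ 0 := by
  obtain ⟨q, hq, hdeg, -, ⟨e⟩⟩ := hR
  intro h
  have h1 : AdjoinRoot.mk q (C ((p : ZMod (p ^ a)) ^ (a - 1))) = 0 := by
    simpa using congrArg e h
  rw [AdjoinRoot.mk_eq_zero] at h1
  have h2 : (p : ZMod (p ^ a)) ^ (a - 1) = 0 := by
    by_contra hne
    exact hq.not_dvd_of_natDegree_lt (C_ne_zero.2 hne) (by rw [natDegree_C]; omega) h1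
  rw [← Nat.cast_pow, ZMod.natCast_eq_zero_iff] at h2
  have := (Nat.pow_dvd_pow_iff_le_right hp.one_lt).1 h2
  omega

theorem natCast_dvd_of_mul_eq_zero (hR : IsGaloisRing p a m R) (hp : p.Prime) (ha : 1 < a) (c : R)
    (hc : p * c = 0) : (p : R) ∣ c := by
  obtain ⟨q, hq, -, -, ⟨e⟩⟩ := hR
  have := AdjoinRoot.natCast_dvd_of_mul_eq_zero (ZMod.natCast_dvd_of_mul_eq_zero hp ha) hq (e c)
    (by rw [← map_natCast e, ← map_mul, hc, map_zero])
  simpa using map_dvd e.symm this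

/-- `R / pR` is the quotient of `(ℤ / p)[y]` by an irreducible polynomial. -/
theorem isMaximal_span_natCast (hR : IsGaloisRing p a m R) (hp : p.Prime) (ha : 1 ≤ a) :
    (Ideal.span {(p : R)}).IsMaximal := by
  obtain ⟨q, -, -, hq, ⟨e⟩⟩ := hR
  have hmax := ZMod.isMaximal_span_prime hp ha
  let := Ideal.Quotient.field (Ideal.span {(p : ZMod (p ^ a))})
  have hqmax : (Ideal.span {q.map (Ideal.Quotient.mk (Ideal.span {(p : ZMod (p ^ a))}))}).IsMaximal :=
    PrincipalIdealRing.isMaximal_of_irreducible hq.2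
  have hfield := (AdjoinRoot.quotAdjoinRootEquivQuotPolynomialQuot
    (Ideal.span {(p : ZMod (p ^ a))}) q).toMulEquiv.isField
      ((Ideal.Quotient.maximal_ideal_iff_isField_quotient _).1 hqmax)
  have h1 := Ideal.Quotient.maximal_of_isField _ hfield
  rw [Ideal.map_span, Set.image_singleton, map_natCast] at h1
  have h2 : Ideal.span {(p : R)} = (Ideal.span {(p : AdjoinRoot q)}).comap e := by
    rw [← Ideal.map_symm, Ideal.map_span, Set.image_singleton]
    simp
  rw [h2]
  exact Ideal.comap_isMaximal_of_equiv e

end IsGaloisRing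

theorem isNilpotentReduction_reduceMod {p a : ℕ} {R : Type*} [CommRing R] (hpa : (p : R) ^ a = 0) :
    IsNilpotentReduction (mapRingHom (Ideal.Quotient.mk (Ideal.span {(p : R)}))) (p : R[X]) where
  surjective := map_surjective _ Ideal.Quotient.mk_surjective
  map_eq_zero_iff f := by
    rw [natCast_dvd_iff_dvd_coeff, coe_mapRingHom, Polynomial.ext_iff]
    simp [Ideal.Quotient.eq_zero_iff_mem, Ideal.mem_span_singleton]
  isNilpotent := ⟨a, by rw [← map_natCast C, ← map_pow, hpa, map_zero]⟩

/-! ### Squarefree decompositions. -/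

namespace IsNilpotentReduction

variable {A D : Type*} [CommRing A] [CommRing D] {φ : A →+* D} {π : A}

theorem mul_add_mem_sq (H : IsNilpotentReduction φ π) {h s α γ : A} (hs : φ h ∣ φ s)
    (hα : φ h ∣ φ α) (hγ : φ h ∣ φ γ) : s * α + π * γ ∈ Ideal.span {π, h} ^ 2 := by
  rw [sq]
  exact add_mem (Ideal.mul_mem_mul (H.mem_span_pair.2 hs) (H.mem_span_pair.2 hα))
    (Ideal.mul_mem_mul (Ideal.subset_span (by simp)) (H.mem_span_pair.2 hγ))

theorem sq_dvd_of_mem_sq (H : IsNilpotentReduction φ π) {h f : A}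
    (hf : f ∈ Ideal.span {π, h} ^ 2) : φ h ^ 2 ∣ φ f := by
  obtain ⟨x, y, z, rfl⟩ := mem_span_pair_sq.1 hf
  simp [H.map_self]

variable [IsDomain D]

/-- `φ h` divides `φ s` only once while its square divides `φ s * φ α`, so it divides `φ α`. Then `s
* α`, hence `π * γ`, lies in the square. -/
theorem dvd_and_dvd_of_mem_sq (H : IsNilpotentReduction φ π) (hann : ∀ c, π * c = 0 → π ∣ c)
    {h s α γ : A} (hh : Prime (φ h)) (hs : Squarefree (φ s)) (hhs : φ h ∣ φ s)
    (hmem : s * α + π * γ ∈ Ideal.span {π, h} ^ 2) : φ h ∣ φ α ∧ φ h ∣ φ γ := by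
  have hα : φ h ∣ φ α := by
    have h2 := H.sq_dvd_of_mem_sq hmem
    simp only [map_add, map_mul, H.map_self, zero_mul, add_zero] at h2
    obtain ⟨k, hk⟩ := hhs
    have hk' : ¬ φ h ∣ k := fun hd =>
      hh.not_isUnit (hs (φ h) (hk ▸ mul_dvd_mul_left _ hd))
    rw [hk, sq, mul_assoc, mul_dvd_mul_iff_left hh.ne_zero] at h2
    exact (hh.dvd_or_dvd h2).resolve_left hk'
  refine ⟨hα, (H.dvd_of_mem_span_pair_sq hann hh.ne_zero (u := γ) (v := 0) ?_).1⟩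
  have := sub_mem hmem (H.mul_add_mem_sq (γ := 0) hhs hα (by simp))
  convert this using 1
  ring

end IsNilpotentReduction

theorem exists_isSquarefreePart {K : Type*} [Field K] {F : K[X]} (hF : F ≠ 0) :
    ∃ s, IsSquarefreePart s F := by
  classical
  exact ⟨UniqueFactorizationMonoid.radical F, UniqueFactorizationMonoid.squarefree_radical,
    UniqueFactorizationMonoid.radical_dvd_self, fun q hq hqF =>
      (UniqueFactorizationMonoid.dvd_radical_iff_of_irreducible hq hF).2 hqF⟩

/-! ### The four equivalent conditions. -/

theorem theorem5p2 (p a m : ℕ) (hp : p.Prime) (ha : 1 ≤ a) (hm : 1 ≤ m)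
    (R : Type*) [CommRing R] (hR : IsGaloisRing p a m R)
    (f : R[X]) (hf : IsRegularPoly f) :
    List.TFAE [
      ¬ IsPrincipalIdealRing (R[X] ⧸ Ideal.span {f}),
      1 < a ∧ ∃ (r : ℕ) (g : Fin r → R[X]) (δ : R[X]), IsPrimaryCoprimeFactorization f δ g ∧
        ∃ (i : Fin r) (h β : R[X]) (t : ℕ), g i = h ^ t + (p : R[X]) * β ∧
          IsBasicIrreducible p h ∧ 1 < t ∧ β ∈ Ideal.span {(p : R[X]), h},
      1 < a ∧ ¬ Squarefree (reduceMod p f) ∧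
        ∀ f' α γ : R[X], IsSquarefreeDecomposition p f f' α γ →
          reduceMod p γ = 0 ∨ ¬ IsCoprime (reduceMod p α) (reduceMod p γ),
      1 < a ∧ ¬ Squarefree (reduceMod p f) ∧
        ∃ f' α γ : R[X], IsSquarefreeDecomposition p f f' α γ ∧
          (reduceMod p γ = 0 ∨ ¬ IsCoprime (reduceMod p α) (reduceMod p γ))] := by
  have hmax := hR.isMaximal_span_natCast hp ha
  let := Ideal.Quotient.field (Ideal.span {(p : R)})
  have H := isNilpotentReduction_reduceMod hR.natCast_pow_eq_zero
  have hann : 1 < a → ∀ c : R[X], p * c = 0 → (p : R[X]) ∣ c := fun h1 =>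
    natCast_dvd_of_mul_eq_zero (hR.natCast_dvd_of_mul_eq_zero hp h1)
  simp only [IsSquarefreeDecomposition, IsBasicIrreducible]
  have hred : ∀ u : R[X],
      reduceMod p u = mapRingHom (Ideal.Quotient.mk (Ideal.span {(p : R)})) u := fun _ => rfl
  simp only [hred]
  set φ := mapRingHom (Ideal.Quotient.mk (Ideal.span {(p : R)}))
  -- A multiple of `p` is killed by the nonzero constant `p ^ (a - 1)`.
  have hf0 : φ f ≠ 0 := by
    intro h0
    obtain ⟨c, rfl⟩ := (H.map_eq_zero_iff f).1 h0
    have hz : (p : R[X]) ^ (a - 1) * (p * c) = 0 := by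
      rw [← mul_assoc, ← pow_succ, Nat.sub_add_cancel ha, ← map_natCast C, ← map_pow,
        hR.natCast_pow_eq_zero, map_zero, zero_mul]
    have := (mem_nonZeroDivisors_iff.1 hf).2 _ hz
    rw [← map_natCast C, ← map_pow, C_eq_zero] at this
    exact hR.natCast_pow_pred_ne_zero hp ha hm this
  -- The common criterion: `f` lies in the square of a maximal ideal `(p, h)`.
  have key : ¬ IsPrincipalIdealRing (R[X] ⧸ Ideal.span {f}) ↔
      1 < a ∧ ∃ h, Irreducible (φ h) ∧ f ∈ Ideal.span {(p : R[X]), h} ^ 2 := by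
    refine ⟨fun hB => ?_, fun ⟨h1, h, hh, hfh⟩ =>
      H.not_isPrincipalIdealRing_quotient (hann h1) hh hfh⟩
    by_contra! hne
    refine hB ?_
    rcases ha.lt_or_eq with h1 | rfl
    · exact H.isPrincipalIdealRing_quotient hf0 (hne h1)
    -- For `a = 1`, `R` is a field and `R[X]` is already principal.
    · have hp0 : (p : R) = 0 := by simpa using hR.natCast_pow_eq_zero
      rw [hp0, Ideal.span_singleton_zero] at hmax
      have := nontrivial_of_ne _ _ (hR.natCast_pow_pred_ne_zero hp ha hm)
      let := (Ring.isField_iff_maximal_bot.2 hmax).toField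
      exact IsPrincipalIdealRing.of_surjective _ Ideal.Quotient.mk_surjective
  tfae_have 1 → 2 := by
    rw [key]
    rintro ⟨h1, h, hh, hfh⟩
    obtain ⟨r, g, δ, hδ, hfg, hg, hgc⟩ := H.exists_factorization hf0
    obtain ⟨i, hi⟩ := H.exists_factor_mem_sq hh hfh hδ hfg hgc
    refine ⟨h1, r, g, δ, ⟨hδ, hfg, fun i => ?_, fun i => ?_, hgc⟩, i, ?_⟩
    · have : f ∈ nonZeroDivisors R[X] := hf
      rw [hfg, mul_mem_nonZeroDivisors, ← Finset.mul_prod_erase _ _ (Finset.mem_univ i),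
        mul_mem_nonZeroDivisors] at this
      exact this.2.1
    · obtain ⟨k, t, hk, ht, hgk⟩ := hg i
      exact H.isPrimary_span_singleton hk ht hgk
    · obtain ⟨k, t, hk, ht, hgk⟩ := hg i
      obtain ⟨β, hβ⟩ := H.exists_of_map_eq (x := g i) (y := k ^ t) (by simp [hgk])
      have hassoc : Associated (φ h) (φ k) := by
        refine hh.associated_of_dvd hk (hh.prime.dvd_of_dvd_pow (n := t) ?_)
        rw [← hgk]
        exact H.mem_span_pair.1 (Ideal.pow_le_self two_ne_zero hi)
      have hspan : Ideal.span {(p : R[X]), h} = Ideal.span {(p : R[X]), k} := by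
        ext x
        rw [H.mem_span_pair, H.mem_span_pair, hassoc.dvd_iff_dvd_left]
      rw [hspan, hβ] at hi
      obtain ⟨ht1, hβk⟩ := H.two_le_and_mem_of_mem_sq (hann h1) hk hi
      exact ⟨k, β, t, hβ, ⟨H.irreducible_of_map hk, hk⟩, ht1, hβk⟩
  tfae_have 2 → 1 := by
    rw [key]
    rintro ⟨h1, r, g, δ, hfac, i, h, β, t, hg, ⟨-, hh⟩, ht, hβ⟩
    refine ⟨h1, h, hh, ?_⟩
    rw [hfac.eq_mul_prod, ← Finset.mul_prod_erase _ _ (Finset.mem_univ i)]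
    refine Ideal.mul_mem_left _ _ (Ideal.mul_mem_right _ _ ?_)
    obtain ⟨t, rfl⟩ := Nat.exists_eq_add_of_lt ht
    rw [hg, show 1 + t + 1 = (t + 1) + 1 by ring, pow_succ' h (t + 1)]
    exact H.mul_add_mem_sq dvd_rfl (by simp [pow_succ]) (H.mem_span_pair.1 hβ)
  tfae_have 1 → 3 := by
    rw [key]
    rintro ⟨h1, h, hh, hfh⟩
    have hsq := H.sq_dvd_of_mem_sq hfh
    refine ⟨h1, fun hsf => hh.not_isUnit (hsf _ (sq (φ h) ▸ hsq)), ?_⟩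
    rintro s α γ ⟨⟨hs, -, hsirr⟩, rfl⟩
    obtain ⟨hα, hγ⟩ := H.dvd_and_dvd_of_mem_sq (hann h1) hh.prime hs
      (hsirr _ hh ((dvd_pow_self _ two_ne_zero).trans hsq)) hfh
    exact Or.inr fun hc => hh.not_isUnit (hc.isUnit_of_dvd' hα hγ)
  tfae_have 3 → 4 := by
    rintro ⟨h1, hsf, hall⟩
    obtain ⟨s', hs⟩ := exists_isSquarefreePart hf0
    obtain ⟨α', hα⟩ := hs.2.1
    obtain ⟨s, rfl⟩ := H.surjective s'
    obtain ⟨α, rfl⟩ := H.surjective α'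
    obtain ⟨γ, hγ⟩ := H.exists_of_map_eq (hα.trans (map_mul φ s α).symm)
    exact ⟨h1, hsf, s, α, γ, ⟨hs, hγ⟩, hall s α γ ⟨hs, hγ⟩⟩
  tfae_have 4 → 1 := by
    rw [key]
    rintro ⟨h1, hsf, s, α, γ, ⟨⟨hs, -, hsirr⟩, rfl⟩, hαγ⟩
    have hφ : φ (s * α + p * γ) = φ s * φ α := by simp [H.map_self]
    rw [hφ] at hsf hf0 hsirr
    have hnc : ¬ IsCoprime (φ α) (φ γ) := by
      rcases hαγ with h0 | hnc
      -- Otherwise `φ α` is a unit and `φ f` is associated to the squarefree `φ s`.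
      · rw [h0, isCoprime_zero_right]
        intro hu
        exact hsf (hs.squarefree_of_dvd (hu.mul_right_dvd.2 dvd_rfl))
      · exact hnc
    obtain ⟨k, hk, hkα, hkγ⟩ : ∃ k, Irreducible k ∧ k ∣ φ α ∧ k ∣ φ γ := by
      by_contra! hno
      exact hnc (isCoprime_of_irreducible_dvd (fun h => right_ne_zero_of_mul hf0 h.1) hno)
    obtain ⟨h, rfl⟩ := H.surjective k
    exact ⟨h1, h, hk, H.mul_add_mem_sq (hsirr _ hk (hkα.mul_left _)) hkα hkγ⟩
  tfae_finish
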